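/- Let $X$ be a (real or complex) Banach space with dual $X'$. A norm bounded set $A\subset X$ is a Dunford-Pettis (DP) set if every weakly null sequence $(f_n)$ in $X'$ satisfies $\lim_n\sup_{x\in A}|f_n(x)|=0$. A norm bounded set $A\subset X'$ is an L-Dunford-Pettis set if $\lim_n\sup_{f\in A}|f(x_n)|=0$ for every weakly null sequence $(x_n)$ in $X$ whose set of terms is a DP set. The space $X$ has the L-Dunford-Pettis property if every L-Dunford-Pettis set in $X'$ is relatively weakly compact, i.e. relatively compact for $\sigma(X',X'')$. Let $L(X,\ell^\infty)$ be the space of bounded linear operators from $X$ to $\ell^\infty$ with the operator norm; let $W(X,\ell^\infty)$ be its subspace of weakly compact operators (those mapping the closed unit ball of $X$ to a relatively weakly compact set), and $DPcc(X,\ell^\infty)$ its subspace of Dunford-Pettis completely continuous operators, i.e. those $T$ with $\|Tx_n\|\to 0$ for every weakly null sequence $(x_n)$ in $X$ whose set of terms is a DP set. Then the following assertions are equivalent: 1. $X$ has the L-Dunford-Pettis property; 2. $W(X,\ell^\infty)=DPcc(X,\ell^\infty)$; 3. $W(X,\ell^\infty)$ is complemented in $DPcc(X,\ell^\infty)$,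 i.e. $W(X,\ell^\infty)\subset DPcc(X,\ell^\infty)$ and there is a bounded linear projection of $DPcc(X,\ell^\infty)$ onto $W(X,\ell^\infty)$. -/

import Mathlib

open Filter Topology
open scoped ENNReal

noncomputable section

namespace LDP

section Sets

variable (𝕜 : Type*) [RCLike 𝕜] {E : Type*} [NormedAddCommGroup E] [NormedSpace 𝕜 E]

/-- A sequence that converges to `0` in the weak topology `σ(E, E')`. -/
def WeaklyNull (x : ℕ → E) : Prop :=
  Tendsto (fun n => toWeakSpace 𝕜 E (x n)) atTop (𝓝 0)

/-- A set whose closure in the weak topology `σ(E, E')` is weakly compact. -/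
def RelWeaklyCompact (A : Set E) : Prop :=
  IsCompact (closure (toWeakSpace 𝕜 E '' A))

/-- Dunford-Pettis set: a norm bounded set on which every weakly null sequence of the dual
(weakly null for `σ(E', E'')`) converges uniformly to zero. -/
def IsDPSet (A : Set E) : Prop :=
  Bornology.IsBounded A ∧
    ∀ f : ℕ → StrongDual 𝕜 E, WeaklyNull 𝕜 f →
      TendstoUniformlyOn (fun n (x : E) => f n x) (fun _ => 0) atTop A

/-- L-Dunford-Pettis set: a norm bounded set of functionals on which every weakly null sequence of
`E` whose range is a Dunford-Pettis set converges uniformly to zero. -/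
def IsLDPSet (A : Set (StrongDual 𝕜 E)) : Prop :=
  Bornology.IsBounded A ∧
    ∀ x : ℕ → E, WeaklyNull 𝕜 x → IsDPSet 𝕜 (Set.range x) →
      TendstoUniformlyOn (fun n (f : StrongDual 𝕜 E) => f (x n)) (fun _ => 0) atTop A

variable (E) in
/-- The L-Dunford-Pettis property: L-Dunford-Pettis sets of the dual are relatively compact for
the weak topology `σ(E', E'')`. -/
def HasLDPProperty : Prop :=
  ∀ A : Set (StrongDual 𝕜 E), IsLDPSet 𝕜 A → RelWeaklyCompact 𝕜 A

end Sets

section Operators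

variable {𝕜 : Type*} [RCLike 𝕜]
  {E : Type*} [NormedAddCommGroup E] [NormedSpace 𝕜 E]
  {F : Type*} [NormedAddCommGroup F] [NormedSpace 𝕜 F]

/-- Dunford-Pettis completely continuous operator. -/
def IsDPcc (T : E →L[𝕜] F) : Prop :=
  ∀ x : ℕ → E, WeaklyNull 𝕜 x → IsDPSet 𝕜 (Set.range x) →
    Tendsto (fun n => T (x n)) atTop (𝓝 0)

/-- Weakly compact operator. -/
def IsWeaklyCompactOp (T : E →L[𝕜] F) : Prop :=
  RelWeaklyCompact 𝕜 (T '' Metric.closedBall 0 1)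

theorem isWeaklyCompactOp_of_subset {T : E →L[𝕜] F} {K : Set (WeakSpace 𝕜 F)} (hK : IsCompact K)
    (h : ∀ x ∈ Metric.closedBall (0 : E) 1, toWeakSpace 𝕜 F (T x) ∈ K) :
    IsWeaklyCompactOp T := by
  refine hK.closure_of_subset ?_
  rintro _ ⟨_, ⟨x, hx, rfl⟩, rfl⟩
  exact h x hx

theorem IsWeaklyCompactOp.mem {T : E →L[𝕜] F} {x : E} (hx : x ∈ Metric.closedBall (0 : E) 1) :
    toWeakSpace 𝕜 F (T x) ∈ closure (toWeakSpace 𝕜 F '' (T '' Metric.closedBall 0 1)) :=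
  subset_closure ⟨_, ⟨x, hx, rfl⟩, rfl⟩

variable (𝕜 E F)

/-- The space of weakly compact operators, inside `E →L[𝕜] F` with the operator norm. -/
def W : Submodule 𝕜 (E →L[𝕜] F) where
  carrier := {T | IsWeaklyCompactOp T}
  zero_mem' := isWeaklyCompactOp_of_subset (isCompact_singleton (x := 0)) (by simp)
  add_mem' {S T} hS hT :=
    isWeaklyCompactOp_of_subset ((IsCompact.prod hS hT).image continuous_add) fun _ hx =>
      ⟨(_, _), ⟨IsWeaklyCompactOp.mem hx, IsWeaklyCompactOp.mem hx⟩, by simp⟩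
  smul_mem' c T hT :=
    isWeaklyCompactOp_of_subset (IsCompact.image hT (continuous_const_smul c)) fun _ hx =>
      ⟨_, IsWeaklyCompactOp.mem hx, by simp⟩

/-- The space of Dunford-Pettis completely continuous operators, inside `E →L[𝕜] F` with the
operator norm. -/
def DPcc : Submodule 𝕜 (E →L[𝕜] F) where
  carrier := {T | IsDPcc T}
  zero_mem' := fun x _ _ => by simp
  add_mem' {S T} hS hT := fun x h h' => by simpa using (hS x h h').add (hT x h h')
  smul_mem' c T hT := fun x h h' => by simpa using (hT x h h').const_smul c

end Operators

/-- `p` is a complemented subspace of `q`: it is contained in `q`, and there is a bounded linear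
projection of `q` onto `p`. -/
def ComplementedIn {𝕜 : Type*} [RCLike 𝕜] {E : Type*} [NormedAddCommGroup E] [NormedSpace 𝕜 E]
    (p q : Submodule 𝕜 E) : Prop :=
  p ≤ q ∧ (p.submoduleOf q).ClosedComplemented

/-- The Banach space of bounded scalar sequences with the supremum norm. -/
abbrev EllInfty (𝕜 : Type*) [RCLike 𝕜] : Type _ := lp (fun _ : ℕ => 𝕜) ∞

end LDP

end

/-!
By Grothendieck's double limit criterion, a bounded set is relatively weakly compact as soon as the
iterated limits of its pairing with a unit ball agree whenever they exist. The criterion is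
symmetric, so an operator `T` is weakly compact if and only if the image of the dual unit ball under
its adjoint is relatively weakly compact (Gantmacher), while `T` is Dunford-Pettis completely
continuous if and only if this image is an L-Dunford-Pettis set. Relatively weakly compact sets of
functionals are L-Dunford-Pettis by the Eberlein-Šmulian theorem; hence `W ≤ DPcc`, with equality
under the L-Dunford-Pettis property.

Conversely, let `P` be a projection of `DPcc` onto `W`, let `f n` lie in an L-Dunford-Pettis set `A`
and let `x m` lie in the unit ball. Then `T x = (f n x)ₙ` belongs to `DPcc`, and so does `b T` for
every multiplier `b` in `ℓ^∞`. Since `b ↦ b T - P (b T)` kills finitely supported `b`, Whitley's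
argument with an uncountable almost disjoint family (the one proving that `c₀` is not complemented
in `ℓ^∞`) gives an infinite `M` at whose indicator `b` all the countably many numbers
`(b T - P (b T)) (x m) n` vanish. So the `f n (x m)` with `n` in `M` are coordinates of the values
at the `x m` of one weakly compact operator, and the iterated limits of `f n (x m)` agree.
-/

namespace LDP

section IteratedLimits

variable {α β Z : Type*} [TopologicalSpace Z] {A : Set α} {B : Set β} {p : α → β → Z}

/-- Grothendieck's double limit condition: for sequences `a` in `A` and `b` in `B`, the iterated
limits `r` and `s` of `p (a n) (b m)` coincide whenever they both exist. The inner limits `u` and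
`v` are part of the data, so that no limit is ever taken as a junk value. -/
def IteratedLimitsAgree (A : Set α) (B : Set β) (p : α → β → Z) : Prop :=
  ∀ (a : ℕ → α) (b : ℕ → β), (∀ n, a n ∈ A) → (∀ m, b m ∈ B) →
    ∀ (u v : ℕ → Z) (r s : Z),
      (∀ n, Tendsto (fun m => p (a n) (b m)) atTop (𝓝 (u n))) → Tendsto u atTop (𝓝 r) →
      (∀ m, Tendsto (fun n => p (a n) (b m)) atTop (𝓝 (v m))) → Tendsto v atTop (𝓝 s) → r = s

namespace IteratedLimitsAgree

theorem flip (h : IteratedLimitsAgree A B p) : IteratedLimitsAgree B A fun b a => p a b :=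
  fun b a hb ha u v r s hu hr hv hs => (h a b ha hb v u s r hv hs hu hr).symm

theorem comp {γ δ : Type*} {A' : Set γ} {B' : Set δ} {i : γ → α} {j : δ → β}
    (h : IteratedLimitsAgree A B p) (hi : Set.MapsTo i A' A) (hj : Set.MapsTo j B' B) :
    IteratedLimitsAgree A' B' fun c d => p (i c) (j d) :=
  fun a b ha hb => h (i ∘ a) (j ∘ b) (fun n => hi (ha n)) fun m => hj (hb m)

theorem image_left {γ : Type*} {C : Set γ} {i : γ → α}
    (h : IteratedLimitsAgree C B fun c b => p (i c) b) : IteratedLimitsAgree (i '' C) B p := by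
  intro a b ha hb
  choose c hc hca using ha
  obtain rfl : (fun n => i (c n)) = a := funext hca
  exact h c b hc hb

/-- Pick the terms of the two sequences in turns: each new `a` follows `l₁` closely enough for the
finitely many `b` already chosen, and each new `b` follows `l₂` closely enough for the finitely
many `a`. -/
theorem eq_of_tendsto [FirstCountableTopology Z] (h : IteratedLimitsAgree A B p)
    {l₁ : Filter α} {l₂ : Filter β} [l₁.NeBot] [l₂.NeBot] (hA : ∀ᶠ a in l₁, a ∈ A)
    (hB : ∀ᶠ b in l₂, b ∈ B)
    {u : α → Z} {v : β → Z} {r s : Z}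
    (hu : ∀ a ∈ A, Tendsto (p a) l₂ (𝓝 (u a))) (hr : Tendsto u l₁ (𝓝 r))
    (hv : ∀ b ∈ B, Tendsto (fun a => p a b) l₁ (𝓝 (v b))) (hs : Tendsto v l₂ (𝓝 s)) :
    r = s := by
  choose U hU using fun z : Z => (𝓝 z).exists_antitone_basis
  obtain ⟨g, hg, hgg⟩ := exists_seq_of_forall_finset_exists (α := ℕ × α × β)
    (fun x => (x.2.1 ∈ A ∧ u x.2.1 ∈ U r x.1) ∧ x.2.2 ∈ B ∧ v x.2.2 ∈ U s x.1)
    (fun x y => x.1 < y.1 ∧ p y.2.1 x.2.2 ∈ U (v x.2.2) y.1 ∧ p x.2.1 y.2.2 ∈ U (u x.2.1) y.1)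
    (by
      intro S hS
      obtain ⟨N, hN⟩ : ∃ N : ℕ, ∀ x ∈ S, x.1 < N :=
        ⟨S.sup Prod.fst + 1, fun x hx => Nat.lt_succ_of_le (Finset.le_sup (f := Prod.fst) hx)⟩
      obtain ⟨a, ⟨ha, hau⟩, haS⟩ := ((hA.and (hr ((hU r).mem N))).and
        ((Finset.eventually_all S).2 fun x hx =>
          hv x.2.2 (hS x hx).2.1 ((hU (v x.2.2)).mem N))).exists
      obtain ⟨b, ⟨hb, hbv⟩, hbS⟩ := ((hB.and (hs ((hU s).mem N))).and
        ((Finset.eventually_all S).2 fun x hx =>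
          hu x.2.1 (hS x hx).1.1 ((hU (u x.2.1)).mem N))).exists
      exact ⟨(N, a, b), ⟨⟨ha, hau⟩, hb, hbv⟩, fun x hx => ⟨hN x hx, haS x hx, hbS x hx⟩⟩)
  have hmono : StrictMono fun n => (g n).1 := fun m n hmn => (hgg m n hmn).1
  have tendsto_of_mem {w : ℕ → Z} {z : Z} (N : ℕ) (hw : ∀ n, N < n → w n ∈ U z (g n).1) :
      Tendsto w atTop (𝓝 z) :=
    (hU z).toHasBasis.tendsto_right_iff.2 fun i _ => by
      filter_upwards [eventually_gt_atTop N, eventually_ge_atTop i] with n hNn hin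
      exact (hU z).antitone (hin.trans (hmono.id_le n)) (hw n hNn)
  exact h (fun n => (g n).2.1) (fun n => (g n).2.2) (fun n => (hg n).1.1) (fun n => (hg n).2.1)
    (fun n => u (g n).2.1) (fun n => v (g n).2.2) r s
    (fun n => tendsto_of_mem n fun m hm => (hgg n m hm).2.2)
    (tendsto_of_mem 0 fun n _ => (hg n).1.2)
    (fun m => tendsto_of_mem m fun n hn => (hgg m n hn).2.1)
    (tendsto_of_mem 0 fun n _ => (hg n).2.2)

end IteratedLimitsAgree

theorem eq_of_mapClusterPt_of_tendsto [T2Space Z] {l : Filter α} {w : α → Z} {x y : Z}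
    (hx : MapClusterPt x l w) (hy : Tendsto w l (𝓝 y)) : x = y :=
  haveI : NeBot (𝓝 x ⊓ 𝓝 y) := ClusterPt.mono hx hy
  eq_of_nhds_neBot this

/-- If `a` and `b` are cluster points of the two sequences, both iterated limits are `p a b`. -/
theorem iteratedLimitsAgree_of_isCompact [T2Space Z] [TopologicalSpace α] [TopologicalSpace β]
    (hA : IsCompact A) (hB : IsCompact B) (hp₁ : ∀ b, Continuous fun a => p a b)
    (hp₂ : ∀ a, Continuous (p a)) : IteratedLimitsAgree A B p := by
  intro a b ha hb u v r s hu hr hv hs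
  obtain ⟨a₀, -, ha₀⟩ := hA.exists_mapClusterPt (f := atTop) (tendsto_principal.2 (.of_forall ha))
  obtain ⟨b₀, -, hb₀⟩ := hB.exists_mapClusterPt (f := atTop) (tendsto_principal.2 (.of_forall hb))
  have left_clusterPt (y : β) : MapClusterPt (p a₀ y) atTop fun n => p (a n) y :=
    ha₀.continuousAt_comp (hp₁ y).continuousAt
  have right_clusterPt (x : α) : MapClusterPt (p x b₀) atTop fun m => p x (b m) :=
    hb₀.continuousAt_comp (hp₂ x).continuousAt
  obtain rfl : (fun n => p (a n) b₀) = u :=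
    funext fun n => eq_of_mapClusterPt_of_tendsto (right_clusterPt (a n)) (hu n)
  obtain rfl : (fun m => p a₀ (b m)) = v :=
    funext fun m => eq_of_mapClusterPt_of_tendsto (left_clusterPt (b m)) (hv m)
  exact (eq_of_mapClusterPt_of_tendsto (left_clusterPt b₀) hr).symm.trans
    (eq_of_mapClusterPt_of_tendsto (right_clusterPt a₀) hs)

end IteratedLimits

theorem exists_neBot_tendsto_of_mem_closure_image {α Y : Type*} [TopologicalSpace Y] {i : α → Y}
    {A : Set α} {y : Y} (hy : y ∈ closure (i '' A)) :
    ∃ l : Filter α, l.NeBot ∧ (∀ᶠ a in l, a ∈ A) ∧ Tendsto i l (𝓝 y) :=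
  ⟨comap i (𝓝[i '' A] y) ⊓ 𝓟 A,
    comap_inf_principal_neBot_of_image_mem (mem_closure_iff_nhdsWithin_neBot.1 hy)
      self_mem_nhdsWithin,
    mem_inf_of_right (mem_principal_self A),
    (tendsto_comap.mono_left inf_le_left).mono_right nhdsWithin_le_nhds⟩

/-- The continuous functionals on a weak topology are the evaluations, so Hahn-Banach separates by
one of them. -/
theorem exists_forall_re_lt_of_notMem_closure_weakBilin {𝕜 V Y : Type*} [RCLike 𝕜]
    [AddCommGroup V] [Module 𝕜 V] [Module ℝ V] [IsScalarTower ℝ 𝕜 V] [AddCommGroup Y] [Module 𝕜 Y]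
    {B : V →ₗ[𝕜] Y →ₗ[𝕜] 𝕜} {C : Set (WeakBilin B)} (hC : Convex ℝ C) {v : WeakBilin B}
    (hv : v ∉ closure C) :
    ∃ (y : Y) (s : ℝ), (∀ w ∈ C, RCLike.re (B w y) < s) ∧ s < RCLike.re (B v y) := by
  have : ContinuousSMul ℝ (WeakBilin B) := IsScalarTower.continuousSMul 𝕜
  obtain ⟨l, s, hs, hl⟩ :=
    RCLike.geometric_hahn_banach_closed_point (𝕜 := 𝕜) hC.closure isClosed_closure hv
  obtain ⟨y, rfl⟩ := LinearMap.dualEmbedding_surjective B l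
  exact ⟨y, s, fun w hw => hs w (subset_closure hw), hl⟩

section WeakTopology

variable {𝕜 : Type*} [RCLike 𝕜] {E : Type*} [NormedAddCommGroup E] [NormedSpace 𝕜 E]

theorem continuous_eval_weakSpace (f : StrongDual 𝕜 E) :
    Continuous fun x : WeakSpace 𝕜 E => f ((toWeakSpace 𝕜 E).symm x) :=
  WeakBilin.eval_continuous (topDualPairing 𝕜 E).flip f

theorem mapClusterPt_apply_of_toWeakSpace {α : Type*} {l : Filter α} {x : α → E} {x₀ : E}
    (h : MapClusterPt (toWeakSpace 𝕜 E x₀) l fun a => toWeakSpace 𝕜 E (x a))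
    (f : StrongDual 𝕜 E) : MapClusterPt (f x₀) l fun a => f (x a) :=
  MapClusterPt.continuousAt_comp (X := WeakSpace 𝕜 E)
    (continuous_eval_weakSpace f).continuousAt h

theorem tendsto_toWeakSpace_iff {α : Type*} {l : Filter α} {x : α → E} {x₀ : E} :
    Tendsto (fun a => toWeakSpace 𝕜 E (x a)) l (𝓝 (toWeakSpace 𝕜 E x₀)) ↔
      ∀ f : StrongDual 𝕜 E, Tendsto (fun a => f (x a)) l (𝓝 (f x₀)) :=
  WeakBilin.tendsto_iff_forall_eval_tendsto (B := (topDualPairing 𝕜 E).flip) fun _ _ hxy =>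
    (SeparatingDual.eq_iff_forall_dual_eq (R := 𝕜)).2 fun g => DFunLike.congr_fun hxy g

theorem weaklyNull_iff {x : ℕ → E} :
    WeaklyNull 𝕜 x ↔ ∀ f : StrongDual 𝕜 E, Tendsto (fun n => f (x n)) atTop (𝓝 0) := by
  simpa [WeaklyNull] using tendsto_toWeakSpace_iff (𝕜 := 𝕜) (l := atTop) (x := x) (x₀ := 0)

theorem weaklyNull_sub_const_iff {x : ℕ → E} {x₀ : E} :
    WeaklyNull 𝕜 (fun n => x n - x₀) ↔
      Tendsto (fun n => toWeakSpace 𝕜 E (x n)) atTop (𝓝 (toWeakSpace 𝕜 E x₀)) := by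
  simp only [weaklyNull_iff, tendsto_toWeakSpace_iff, map_sub, tendsto_sub_nhds_zero_iff]

theorem isClosed_image_toWeakSpace_submodule {p : Submodule 𝕜 E} (hp : IsClosed (p : Set E)) :
    IsClosed (toWeakSpace 𝕜 E '' (p : Set E)) := by
  let : NormedSpace ℝ E := NormedSpace.restrictScalars ℝ 𝕜 E
  have : IsScalarTower ℝ 𝕜 E := IsScalarTower.restrictScalars ..
  have hconv : Convex ℝ (p : Set E) := (p.restrictScalars ℝ).convex
  rw [← closure_eq_iff_isClosed, ← hconv.toWeakSpace_closure 𝕜, hp.closure_eq]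

theorem mem_of_toWeakSpace_mem_closure_image {A : Set E} {p : Submodule 𝕜 E}
    (hp : IsClosed (p : Set E)) (hA : A ⊆ p) {x : E}
    (hx : toWeakSpace 𝕜 E x ∈ closure (toWeakSpace 𝕜 E '' A)) : x ∈ p :=
  (toWeakSpace 𝕜 E).injective.mem_set_image.1 <|
    closure_minimal (Set.image_mono hA) (isClosed_image_toWeakSpace_submodule hp) hx

theorem RelWeaklyCompact.mono {A B : Set E} (hB : RelWeaklyCompact 𝕜 B) (h : A ⊆ B) :
    RelWeaklyCompact 𝕜 A :=
  IsCompact.of_isClosed_subset hB isClosed_closure (closure_mono (Set.image_mono h))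

theorem RelWeaklyCompact.exists_mapClusterPt {A : Set E} (hA : RelWeaklyCompact 𝕜 A)
    {α : Type*} {l : Filter α} [l.NeBot] {x : α → E} (hx : ∀ᶠ a in l, x a ∈ A) :
    ∃ x₀, toWeakSpace 𝕜 E x₀ ∈ closure (toWeakSpace 𝕜 E '' A) ∧
      MapClusterPt (toWeakSpace 𝕜 E x₀) l fun a => toWeakSpace 𝕜 E (x a) :=
  IsCompact.exists_mapClusterPt hA
    (tendsto_principal.2 (hx.mono fun _ ha => subset_closure (Set.mem_image_of_mem _ ha)))

/-- The range of `J` is norm closed, hence weakly closed. -/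
theorem RelWeaklyCompact.exists_mapClusterPt_apply_of_image {F : Type*} [NormedAddCommGroup F]
    [NormedSpace 𝕜 F] [CompleteSpace E] {J : E →ₗᵢ[𝕜] F} {A : Set E}
    (hA : RelWeaklyCompact 𝕜 (J '' A)) {l : Filter E} [l.NeBot] (hl : ∀ᶠ x in l, x ∈ A) :
    ∃ x₀, ∀ f : StrongDual 𝕜 F, MapClusterPt (f (J x₀)) l fun x => f (J x) := by
  have isClosed_range : IsClosed (LinearMap.range J.toLinearMap : Set F) :=
    J.isometry.isUniformInducing.isComplete_range.isClosed
  obtain ⟨y, hy, hyl⟩ := hA.exists_mapClusterPt (hl.mono fun x => Set.mem_image_of_mem J)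
  obtain ⟨x₀, rfl⟩ :=
    mem_of_toWeakSpace_mem_closure_image isClosed_range (Set.image_subset_range J A) hy
  exact ⟨x₀, mapClusterPt_apply_of_toWeakSpace hyl⟩

theorem norm_le_of_forall_re_le {f : StrongDual 𝕜 E} {C : ℝ}
    (h : ∀ x ∈ Metric.closedBall (0 : E) 1, RCLike.re (f x) ≤ C) : ‖f‖ ≤ C := by
  refine f.opNorm_le_of_unit_norm (by simpa using h 0 (by simp)) fun x hx => ?_
  obtain ⟨c, hc, hcf⟩ := RCLike.exists_norm_eq_mul_self (f x)
  have hcx : f (c • x) = (‖f x‖ : 𝕜) := by rw [map_smul, smul_eq_mul, hcf]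
  simpa only [hcx, RCLike.ofReal_re] using h (c • x) (by simp [norm_smul, hc, hx])

theorem exists_forall_re_lt_of_notMem_closure_weakDual {C : Set (WeakDual 𝕜 E)}
    (hC : Convex ℝ C) {φ : WeakDual 𝕜 E} (hφ : φ ∉ closure C) :
    ∃ (x : E) (s : ℝ), (∀ ψ ∈ C, RCLike.re (ψ x) < s) ∧ s < RCLike.re (φ x) :=
  exists_forall_re_lt_of_notMem_closure_weakBilin (V := StrongDual 𝕜 E)
    (B := topDualPairing 𝕜 E) hC hφ

variable (𝕜 E) in
theorem convex_image_inclusionInDoubleDualWeak_closedBall :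
    Convex ℝ (NormedSpace.inclusionInDoubleDualWeak 𝕜 E ''
      (toWeakSpace 𝕜 E '' Metric.closedBall 0 1)) := by
  let : NormedSpace ℝ E := NormedSpace.restrictScalars ℝ 𝕜 E
  have : IsScalarTower ℝ 𝕜 E := IsScalarTower.restrictScalars ..
  have himage : Convex ℝ (NormedSpace.inclusionInDoubleDual 𝕜 E '' Metric.closedBall 0 1) :=
    (convex_closedBall (0 : E) 1).is_linear_image
      ((NormedSpace.inclusionInDoubleDual 𝕜 E).restrictScalars ℝ).isLinear
  rw [Set.image_image]
  exact himage

/-- **Goldstine's theorem**. -/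
theorem mem_closure_image_closedBall {φ : StrongDual 𝕜 (StrongDual 𝕜 E)} (hφ : ‖φ‖ ≤ 1) :
    StrongDual.toWeakDual φ ∈ closure (NormedSpace.inclusionInDoubleDualWeak 𝕜 E ''
      (toWeakSpace 𝕜 E '' Metric.closedBall 0 1)) := by
  by_contra hn
  obtain ⟨f, s, hs, hl⟩ := exists_forall_re_lt_of_notMem_closure_weakDual
    (convex_image_inclusionInDoubleDualWeak_closedBall 𝕜 E) hn
  have hf : ‖f‖ ≤ s := norm_le_of_forall_re_le fun x hx => (hs _ ⟨_, ⟨x, hx, rfl⟩, rfl⟩).le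
  have hφf : RCLike.re (φ f) ≤ s :=
    (RCLike.re_le_norm _).trans ((φ.le_of_opNorm_le hφ f).trans (by simpa only [one_mul] using hf))
  exact hl.not_ge hφf

theorem RelWeaklyCompact.iteratedLimitsAgree {A : Set E} (hA : RelWeaklyCompact 𝕜 A) :
    IteratedLimitsAgree A (Metric.closedBall (0 : StrongDual 𝕜 E) 1) fun x f => f x := by
  have hpair : IteratedLimitsAgree (closure (toWeakSpace 𝕜 E '' A))
      (WeakDual.toStrongDual ⁻¹' Metric.closedBall (0 : StrongDual 𝕜 E) 1)
      fun x f => f ((toWeakSpace 𝕜 E).symm x) :=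
    iteratedLimitsAgree_of_isCompact hA (WeakDual.isCompact_closedBall 0 1)
      (fun f => continuous_eval_weakSpace (WeakDual.toStrongDual f))
      (fun x => WeakDual.eval_continuous ((toWeakSpace 𝕜 E).symm x))
  exact hpair.comp (i := toWeakSpace 𝕜 E) (j := StrongDual.toWeakDual)
    (fun _ hx => subset_closure (Set.mem_image_of_mem _ hx)) fun _ hf => hf

theorem RelWeaklyCompact.iteratedLimitsAgree_dual {A : Set (StrongDual 𝕜 E)}
    (hA : RelWeaklyCompact 𝕜 A) :
    IteratedLimitsAgree A (Metric.closedBall (0 : E) 1) fun f x => f x :=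
  hA.iteratedLimitsAgree.comp (i := id) (j := NormedSpace.inclusionInDoubleDual 𝕜 E)
    (Set.mapsTo_id A) fun x hx => mem_closedBall_zero_iff.2
      ((NormedSpace.double_dual_bound 𝕜 E x).trans (mem_closedBall_zero_iff.1 hx))

/-- Both sides are iterated limits of `f x`, as `f` in `A` tends to `z` and, by Goldstine's theorem,
`x` in the unit ball tends to `φ`. -/
theorem IteratedLimitsAgree.apply_eq_of_mem_closure {A : Set (StrongDual 𝕜 E)}
    (h : IteratedLimitsAgree A (Metric.closedBall (0 : E) 1) fun f x => f x)
    {z : WeakDual 𝕜 (StrongDual 𝕜 (StrongDual 𝕜 E))}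
    (hz : z ∈ closure (NormedSpace.inclusionInDoubleDualWeak 𝕜 (StrongDual 𝕜 E) ''
      (toWeakSpace 𝕜 (StrongDual 𝕜 E) '' A)))
    {φ : StrongDual 𝕜 (StrongDual 𝕜 E)} (hφ : ‖φ‖ ≤ 1) :
    z φ = φ ((WeakDual.toStrongDual z).comp (NormedSpace.inclusionInDoubleDual 𝕜 E)) := by
  have hφ' := mem_closure_image_closedBall hφ
  rw [Set.image_image] at hz hφ'
  obtain ⟨l₁, _, hlA, hlz⟩ := exists_neBot_tendsto_of_mem_closure_image hz
  obtain ⟨l₂, _, hlball, hlφ⟩ := exists_neBot_tendsto_of_mem_closure_image hφ'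
  have tendsto_z (ψ : StrongDual 𝕜 (StrongDual 𝕜 E)) : Tendsto (fun f => ψ f) l₁ (𝓝 (z ψ)) :=
    ((WeakDual.eval_continuous ψ).tendsto z).comp hlz
  have tendsto_φ (f : StrongDual 𝕜 E) : Tendsto (fun x => f x) l₂ (𝓝 (φ f)) :=
    ((WeakDual.eval_continuous f).tendsto (StrongDual.toWeakDual φ)).comp hlφ
  exact h.eq_of_tendsto hlA hlball (fun f _ => tendsto_φ f) (tendsto_z φ)
    (fun x _ => tendsto_z (NormedSpace.inclusionInDoubleDual 𝕜 E x)) (tendsto_φ _)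

theorem eq_of_forall_norm_le_one_apply_eq {f g : StrongDual 𝕜 E}
    (h : ∀ x, ‖x‖ ≤ 1 → f x = g x) : f = g := by
  refine sub_eq_zero.1 (norm_le_zero_iff.1 (norm_le_of_forall_re_le fun x hx => ?_))
  simp [h x (mem_closedBall_zero_iff.1 hx)]

/-- **Grothendieck's double limit criterion** for sets of functionals. -/
theorem IteratedLimitsAgree.relWeaklyCompact_dual {A : Set (StrongDual 𝕜 E)}
    (h : IteratedLimitsAgree A (Metric.closedBall (0 : E) 1) fun f x => f x)
    (hA : Bornology.IsBounded A) : RelWeaklyCompact 𝕜 A := by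
  refine NormedSpace.isCompact_closure_of_isBounded 𝕜 _ _ ?_ fun z hz => ?_
  · rwa [Set.preimage_image_eq _ (toWeakSpace 𝕜 _).injective]
  · refine ⟨toWeakSpace 𝕜 _
      ((WeakDual.toStrongDual z).comp (NormedSpace.inclusionInDoubleDual 𝕜 E)), ?_⟩
    exact eq_of_forall_norm_le_one_apply_eq fun φ hφ => (h.apply_eq_of_mem_closure hz hφ).symm

/-- The criterion for functionals, applied to the image of `A` in the bidual, makes every weak-star
cluster point of that image a weak one, hence a point of `E`. -/
theorem IteratedLimitsAgree.relWeaklyCompact [CompleteSpace E] {A : Set E}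
    (h : IteratedLimitsAgree A (Metric.closedBall (0 : StrongDual 𝕜 E) 1) fun x f => f x)
    (hA : Bornology.IsBounded A) : RelWeaklyCompact 𝕜 A := by
  have himage : RelWeaklyCompact 𝕜 (NormedSpace.inclusionInDoubleDualLi (E := E) 𝕜 '' A) :=
    IteratedLimitsAgree.relWeaklyCompact_dual h.image_left
      ((NormedSpace.inclusionInDoubleDualLi (E := E) 𝕜).lipschitz.isBounded_image hA)
  refine NormedSpace.isCompact_closure_of_isBounded 𝕜 _ _ ?_ fun z hz => ?_
  · rwa [Set.preimage_image_eq _ (toWeakSpace 𝕜 _).injective]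
  · rw [Set.image_image] at hz
    obtain ⟨l, _, hlA, hlz⟩ := exists_neBot_tendsto_of_mem_closure_image hz
    obtain ⟨x, hx⟩ := himage.exists_mapClusterPt_apply_of_image hlA
    refine ⟨toWeakSpace 𝕜 E x, DFunLike.ext _ _ fun f => ?_⟩
    have hfx : MapClusterPt (f x) l fun a => f a :=
      hx (NormedSpace.inclusionInDoubleDual 𝕜 (StrongDual 𝕜 E) f)
    have hfz : Tendsto (fun a => f a) l (𝓝 (z f)) :=
      ((WeakDual.eval_continuous f).tendsto z).comp hlz
    exact eq_of_mapClusterPt_of_tendsto hfx hfz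

end WeakTopology

section Smulian

/-- The topology of such a compact set is that of pointwise convergence of the countable family,
hence first countable. -/
theorem exists_subseq_tendsto_of_countable_separating {Y ι Z : Type*} [TopologicalSpace Y]
    [Countable ι] [TopologicalSpace Z] [FirstCountableTopology Z] [T2Space Z] {K : Set Y}
    (hK : IsCompact K) {e : ι → Y → Z} (he : ∀ i, Continuous (e i))
    (hsep : ∀ y ∈ K, ∀ y' ∈ K, (∀ i, e i y = e i y') → y = y') {u : ℕ → Y} (hu : ∀ n, u n ∈ K) :
    ∃ y ∈ K, ∃ σ : ℕ → ℕ, StrictMono σ ∧ Tendsto (u ∘ σ) atTop (𝓝 y) := by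
  obtain ⟨_, ⟨y, hy, rfl⟩, σ, hσ, hlim⟩ :=
    (hK.image (continuous_pi he)).tendsto_subseq fun n => Set.mem_image_of_mem _ (hu n)
  have huσ : ∀ᶠ n in atTop, (u ∘ σ) n ∈ K := .of_forall fun n => hu (σ n)
  refine ⟨y, hy, σ, hσ, hK.le_nhds_of_unique_clusterPt huσ
    fun y' hy' hclust => hsep y' hy' y hy fun i => ?_⟩
  exact eq_of_mapClusterPt_of_tendsto (MapClusterPt.continuousAt_comp (he i).continuousAt hclust)
    (((continuous_apply i).tendsto _).comp hlim)

variable {𝕜 : Type*} [RCLike 𝕜] {E : Type*} [NormedAddCommGroup E] [NormedSpace 𝕜 E]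

variable (𝕜) in
/-- Functionals norming the points of a countable dense subset do it. -/
theorem exists_countable_dual_separating {S : Set E} (hS : TopologicalSpace.IsSeparable S) :
    ∃ Φ : Set (StrongDual 𝕜 E), Φ.Countable ∧ ∀ x ∈ S, (∀ φ ∈ Φ, φ x = 0) → x = 0 := by
  obtain ⟨D, hD, hSD⟩ := hS
  choose φ hφ hφd using fun d : E => exists_dual_vector'' 𝕜 d
  refine ⟨φ '' D, hD.image φ, fun x hx hφx => ?_⟩
  by_contra hne
  obtain ⟨d, hd, hxd⟩ := Metric.mem_closure_iff.1 (hSD hx) (‖x‖ / 2) (by positivity)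
  have hdx : ‖d‖ ≤ ‖d - x‖ :=
    calc ‖d‖ = ‖φ d (d - x)‖ := by simp [hφx _ ⟨d, hd, rfl⟩, hφd]
      _ ≤ ‖d - x‖ := by simpa only [one_mul] using (φ d).le_of_opNorm_le (hφ d) (d - x)
  rw [dist_comm, dist_eq_norm] at hxd
  linarith [norm_le_norm_add_norm_sub d x]

/-- **Eberlein-Šmulian theorem**. -/
theorem RelWeaklyCompact.exists_subseq_weaklyNull {A : Set E} (hA : RelWeaklyCompact 𝕜 A)
    {x : ℕ → E} (hx : ∀ n, x n ∈ A) :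
    ∃ (x₀ : E) (σ : ℕ → ℕ), StrictMono σ ∧ WeaklyNull 𝕜 fun n => x (σ n) - x₀ := by
  let p : Submodule 𝕜 E := (Submodule.span 𝕜 (Set.range x)).topologicalClosure
  have hxp : Set.range x ⊆ p :=
    Submodule.subset_span.trans (Submodule.le_topologicalClosure _)
  have isSeparable_p : TopologicalSpace.IsSeparable (p : Set E) := by
    rw [Submodule.topologicalClosure_coe]
    exact ((Set.countable_range x).isSeparable.span (R := 𝕜)).closure
  obtain ⟨Φ, hΦ, hsep⟩ := exists_countable_dual_separating 𝕜 isSeparable_p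
  have := hΦ.to_subtype
  obtain ⟨x₀, -, σ, hσ, hlim⟩ := exists_subseq_tendsto_of_countable_separating
    (hA.mono (Set.range_subset_iff.2 hx)) (u := fun n => toWeakSpace 𝕜 E (x n))
    (fun φ : Φ => continuous_eval_weakSpace φ.1)
    (fun y hy y' hy' h => by
      have hy := mem_of_toWeakSpace_mem_closure_image (Submodule.isClosed_topologicalClosure _) hxp
        (x := (toWeakSpace 𝕜 E).symm y) hy
      have hy' := mem_of_toWeakSpace_mem_closure_image (Submodule.isClosed_topologicalClosure _) hxp
        (x := (toWeakSpace 𝕜 E).symm y') hy'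
      refine (toWeakSpace 𝕜 E).symm.injective (sub_eq_zero.1 (hsep _ (p.sub_mem hy hy') ?_))
      exact fun φ hφ => by rw [map_sub, sub_eq_zero]; exact h ⟨φ, hφ⟩)
    fun n => subset_closure ⟨_, ⟨n, rfl⟩, rfl⟩
  exact ⟨(toWeakSpace 𝕜 E).symm x₀, σ, hσ, weaklyNull_sub_const_iff.2 hlim⟩

end Smulian

section Operators

variable {𝕜 : Type*} [RCLike 𝕜]
  {E : Type*} [NormedAddCommGroup E] [NormedSpace 𝕜 E]
  {F : Type*} [NormedAddCommGroup F] [NormedSpace 𝕜 F] {T : E →L[𝕜] F}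

theorem IsDPSet.tendsto_apply {A : Set E} (hA : IsDPSet 𝕜 A) {x : ℕ → E} (hxA : ∀ n, x n ∈ A)
    (hx : WeaklyNull 𝕜 x) {f : ℕ → StrongDual 𝕜 E} {f₀ : StrongDual 𝕜 E}
    (hf : WeaklyNull 𝕜 fun n => f n - f₀) : Tendsto (fun n => f n (x n)) atTop (𝓝 0) := by
  have hsub : Tendsto (fun n => (f n - f₀) (x n)) atTop (𝓝 0) :=
    tendsto_zero_iff_norm_tendsto_zero.2 <| Metric.tendsto_nhds.2 fun ε hε =>
      (Metric.tendstoUniformlyOn_iff.1 (hA.2 _ hf) ε hε).mono fun n hn => by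
        simpa [dist_eq_norm, norm_sub_rev] using hn (x n) (hxA n)
  simpa using hsub.add (weaklyNull_iff.1 hx f₀)

theorem RelWeaklyCompact.isLDPSet {A : Set (StrongDual 𝕜 E)} (hA : RelWeaklyCompact 𝕜 A)
    (hA' : Bornology.IsBounded A) : IsLDPSet 𝕜 A := by
  refine ⟨hA', fun x hx hDP => SeminormedAddGroup.tendstoUniformlyOn_zero.2 fun ε hε => ?_⟩
  by_contra hfreq
  simp only [not_eventually, not_forall, not_lt] at hfreq
  obtain ⟨τ, hτ, hlarge⟩ := extraction_of_frequently_atTop hfreq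
  choose f hfA hf using hlarge
  obtain ⟨f₀, σ, hσ, hnull⟩ := hA.exists_subseq_weaklyNull hfA
  have hlim : Tendsto (fun n => f (σ n) (x (τ (σ n)))) atTop (𝓝 0) :=
    hDP.tendsto_apply (fun n => Set.mem_range_self _)
      (hx.comp (hτ.comp hσ).tendsto_atTop) hnull
  exact hε.not_ge (ge_of_tendsto' (tendsto_zero_iff_norm_tendsto_zero.1 hlim) fun n => hf (σ n))

/-- The image of the dual unit ball under the adjoint of `T`, through which weak compactness and
Dunford-Pettis complete continuity of `T` are both expressed. -/
def adjointBall (T : E →L[𝕜] F) : Set (StrongDual 𝕜 E) :=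
  (fun g : StrongDual 𝕜 F => g.comp T) '' Metric.closedBall 0 1

theorem isBounded_adjointBall (T : E →L[𝕜] F) : Bornology.IsBounded (adjointBall T) := by
  refine isBounded_iff_forall_norm_le.2 ⟨‖T‖, ?_⟩
  rintro _ ⟨g, hg, rfl⟩
  exact (g.opNorm_comp_le T).trans
    (mul_le_of_le_one_left (norm_nonneg _) (mem_closedBall_zero_iff.1 hg))

theorem forall_mem_adjointBall_norm_lt_iff {x : E} {ε : ℝ} :
    (∀ f ∈ adjointBall T, ‖f x‖ < ε) ↔ ‖T x‖ < ε := by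
  constructor
  · intro h
    obtain ⟨g, hg, hgx⟩ := exists_dual_vector'' 𝕜 (T x)
    simpa [hgx] using h _ ⟨g, mem_closedBall_zero_iff.2 hg, rfl⟩
  · rintro h _ ⟨g, hg, rfl⟩
    exact (g.le_of_opNorm_le (mem_closedBall_zero_iff.1 hg) (T x)).trans_lt (by rwa [one_mul])

theorem isDPcc_iff_isLDPSet_adjointBall : IsDPcc T ↔ IsLDPSet 𝕜 (adjointBall T) := by
  rw [IsLDPSet, and_iff_right (isBounded_adjointBall T)]
  refine forall₃_congr fun x _ _ => ?_
  simp only [Metric.tendsto_nhds, dist_zero_right, ← forall_mem_adjointBall_norm_lt_iff (T := T)]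
  exact SeminormedAddGroup.tendstoUniformlyOn_zero.symm

theorem IsWeaklyCompactOp.iteratedLimitsAgree (hT : IsWeaklyCompactOp T) :
    IteratedLimitsAgree (Metric.closedBall (0 : E) 1) (Metric.closedBall (0 : StrongDual 𝕜 F) 1)
      fun x g => g (T x) :=
  (RelWeaklyCompact.iteratedLimitsAgree hT).comp (i := T) (j := id) (Set.mapsTo_image T _)
    (Set.mapsTo_id _)

theorem IsWeaklyCompactOp.relWeaklyCompact_adjointBall (hT : IsWeaklyCompactOp T) :
    RelWeaklyCompact 𝕜 (adjointBall T) :=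
  have hpair : IteratedLimitsAgree (Metric.closedBall (0 : StrongDual 𝕜 F) 1)
      (Metric.closedBall (0 : E) 1) fun g x => (g.comp T) x := hT.iteratedLimitsAgree.flip
  hpair.image_left.relWeaklyCompact_dual (isBounded_adjointBall T)

theorem isWeaklyCompactOp_of_relWeaklyCompact_adjointBall [CompleteSpace F]
    (hT : RelWeaklyCompact 𝕜 (adjointBall T)) : IsWeaklyCompactOp T := by
  have hpair : IteratedLimitsAgree (Metric.closedBall (0 : E) 1)
      (Metric.closedBall (0 : StrongDual 𝕜 F) 1) fun x g => g (T x) :=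
    hT.iteratedLimitsAgree_dual.flip.comp (Set.mapsTo_id _) fun g => Set.mem_image_of_mem _
  exact hpair.image_left.relWeaklyCompact (T.lipschitz.isBounded_image Metric.isBounded_closedBall)

theorem IsWeaklyCompactOp.isDPcc (hT : IsWeaklyCompactOp T) : IsDPcc T :=
  isDPcc_iff_isLDPSet_adjointBall.2
    (hT.relWeaklyCompact_adjointBall.isLDPSet (isBounded_adjointBall T))

theorem HasLDPProperty.W_eq_DPcc [CompleteSpace F] (h : HasLDPProperty 𝕜 E) :
    W 𝕜 E F = DPcc 𝕜 E F :=
  le_antisymm (fun _ => IsWeaklyCompactOp.isDPcc) fun _ hT =>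
    isWeaklyCompactOp_of_relWeaklyCompact_adjointBall
      (h _ (isDPcc_iff_isLDPSet_adjointBall.1 hT))

theorem complementedIn_refl (p : Submodule 𝕜 E) : ComplementedIn p p :=
  ⟨le_rfl, p.submoduleOf_self ▸ Submodule.closedComplemented_top⟩

end Operators

section AlmostDisjoint

/-- The set of codes of the finite initial segments of a binary sequence. Distinct sequences have
only finitely many initial segments in common, so the branches are an uncountable almost disjoint
family of infinite subsets of `ℕ`. -/
def branch (t : ℕ → Bool) : Set ℕ :=
  Set.range fun n => Encodable.encode ((List.range n).map t)

theorem infinite_branch (t : ℕ → Bool) : (branch t).Infinite :=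
  Set.infinite_range_of_injective fun m n h => by
    simpa using congrArg List.length (Encodable.encode_injective h)

theorem finite_branch_inter {s t : ℕ → Bool} (h : s ≠ t) : (branch s ∩ branch t).Finite := by
  obtain ⟨k, hk⟩ := Function.ne_iff.1 h
  refine ((Set.finite_Iic k).image fun n => Encodable.encode ((List.range n).map s)).subset ?_
  rintro _ ⟨⟨m, rfl⟩, n, hn⟩
  have hlist : (List.range n).map t = (List.range m).map s := Encodable.encode_injective hn
  obtain rfl : n = m := by simpa using congrArg List.length hlist
  refine ⟨n, Set.mem_Iic.2 <| not_lt.1 fun hkn => hk ?_, rfl⟩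
  exact (List.map_inj_left.1 hlist k (List.mem_range.2 hkn)).symm

end AlmostDisjoint

section EllInfty

variable {𝕜 : Type*} [RCLike 𝕜]

variable (𝕜) in
/-- The indicator sequence of a set of natural numbers, as an element of `ℓ^∞`. -/
noncomputable def indicatorSeq (M : Set ℕ) : EllInfty 𝕜 :=
  ⟨M.indicator 1, memℓp_infty ⟨1, by
    rintro _ ⟨n, rfl⟩
    simpa using norm_indicator_le_norm_self (s := M) (1 : ℕ → 𝕜) n⟩⟩

theorem indicatorSeq_apply (M : Set ℕ) (n : ℕ) :
    indicatorSeq 𝕜 M n = M.indicator (1 : ℕ → 𝕜) n :=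
  rfl

theorem sum_smul_indicatorSeq_apply {ι : Type*} (S : Finset ι) (c : ι → 𝕜) (B : ι → Set ℕ)
    (n : ℕ) :
    (∑ t ∈ S, c t • indicatorSeq 𝕜 (B t)) n = ∑ t ∈ S, (B t).indicator (fun _ => c t) n := by
  classical
  simp only [lp.coeFn_sum, Finset.sum_apply, lp.coeFn_smul, Pi.smul_apply, smul_eq_mul,
    indicatorSeq_apply, Set.indicator_apply, Pi.one_apply, mul_ite, mul_one, mul_zero]

theorem norm_sum_smul_indicatorSeq_le_one {ι : Type*} {S : Finset ι} {B : ι → Set ℕ}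
    (hB : (S : Set ι).PairwiseDisjoint B) {c : ι → 𝕜} (hc : ∀ t, ‖c t‖ ≤ 1) :
    ‖∑ t ∈ S, c t • indicatorSeq 𝕜 (B t)‖ ≤ 1 := by
  refine lp.norm_le_of_forall_le zero_le_one fun n => ?_
  rw [sum_smul_indicatorSeq_apply]
  by_cases hn : ∃ t ∈ S, n ∈ B t
  · obtain ⟨t, ht, hnt⟩ := hn
    have sum_eq : ∑ s ∈ S, (B s).indicator (fun _ => c s) n = c t := by
      rw [Finset.sum_eq_single_of_mem t ht fun s hs hst => Set.indicator_of_notMem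
        (fun hns => (hB hs ht hst).notMem_of_mem_left hns hnt) _, Set.indicator_of_mem hnt]
    exact sum_eq ▸ hc t
  · push Not at hn
    rw [Finset.sum_eq_zero fun t ht => Set.indicator_of_notMem (hn t ht) _, norm_zero]
    exact zero_le_one

theorem sum_norm_apply_indicatorSeq_le (ψ : StrongDual 𝕜 (EllInfty 𝕜)) {ι : Type*} {S : Finset ι}
    {B : ι → Set ℕ} (hB : (S : Set ι).PairwiseDisjoint B) :
    ∑ t ∈ S, ‖ψ (indicatorSeq 𝕜 (B t))‖ ≤ ‖ψ‖ := by
  choose c hc hcψ using fun t => RCLike.exists_norm_eq_mul_self (ψ (indicatorSeq 𝕜 (B t)))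
  have apply_sum : ψ (∑ t ∈ S, c t • indicatorSeq 𝕜 (B t)) =
      ((∑ t ∈ S, ‖ψ (indicatorSeq 𝕜 (B t))‖ : ℝ) : 𝕜) := by
    simp only [map_sum, map_smul, smul_eq_mul, hcψ]
  calc ∑ t ∈ S, ‖ψ (indicatorSeq 𝕜 (B t))‖
      = ‖ψ (∑ t ∈ S, c t • indicatorSeq 𝕜 (B t))‖ := by
        rw [apply_sum, RCLike.norm_of_nonneg (Finset.sum_nonneg fun t _ => norm_nonneg _)]
    _ ≤ ‖ψ‖ := ψ.unit_le_opNorm _ (norm_sum_smul_indicatorSeq_le_one hB fun t => (hc t).le)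

theorem apply_indicatorSeq_eq_zero_of_finite {ψ : StrongDual 𝕜 (EllInfty 𝕜)}
    (hψ : ∀ n, ψ (indicatorSeq 𝕜 {n}) = 0) {D : Set ℕ} (hD : D.Finite) :
    ψ (indicatorSeq 𝕜 D) = 0 := by
  classical
  have sum_singletons : indicatorSeq 𝕜 D = ∑ n ∈ hD.toFinset, indicatorSeq 𝕜 {n} := by
    ext k
    rw [lp.coeFn_sum]
    simp [indicatorSeq_apply, Set.indicator_apply]
  rw [sum_singletons, map_sum, Finset.sum_eq_zero fun n _ => hψ n]

theorem apply_indicatorSeq_diff_of_finite {ψ : StrongDual 𝕜 (EllInfty 𝕜)}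
    (hψ : ∀ n, ψ (indicatorSeq 𝕜 {n}) = 0) (B : Set ℕ) {D : Set ℕ} (hD : D.Finite) :
    ψ (indicatorSeq 𝕜 (B \ D)) = ψ (indicatorSeq 𝕜 B) := by
  have inter_add_diff : indicatorSeq 𝕜 B = indicatorSeq 𝕜 (B ∩ D) + indicatorSeq 𝕜 (B \ D) := by
    ext k
    by_cases hB : k ∈ B <;> by_cases hD : k ∈ D <;>
      simp [indicatorSeq_apply, hB, hD]
  rw [inter_add_diff, map_add, apply_indicatorSeq_eq_zero_of_finite hψ (hD.inter_of_right B),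
    zero_add]

/-- Removing the finitely many common points of the sets `B t`, `t ∈ S`, makes them disjoint. -/
theorem sum_norm_apply_indicatorSeq_le_of_finite_inter {ψ : StrongDual 𝕜 (EllInfty 𝕜)}
    (hψ : ∀ n, ψ (indicatorSeq 𝕜 {n}) = 0) {ι : Type*} {B : ι → Set ℕ}
    (hB : Pairwise fun s t => (B s ∩ B t).Finite) (S : Finset ι) :
    ∑ t ∈ S, ‖ψ (indicatorSeq 𝕜 (B t))‖ ≤ ‖ψ‖ := by
  classical
  let D : Set ℕ := ⋃ p ∈ S.offDiag, B p.1 ∩ B p.2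
  have hD : D.Finite := S.offDiag.finite_toSet.biUnion fun p hp =>
    hB (Finset.mem_offDiag.1 hp).2.2
  have disjoint_diff : (S : Set ι).PairwiseDisjoint fun t => B t \ D := fun s hs t ht hst =>
    Set.disjoint_left.2 fun k hks hkt => hks.2 <|
      Set.mem_biUnion (x := (s, t)) (Finset.mem_offDiag.2 ⟨hs, ht, hst⟩) ⟨hks.1, hkt.1⟩
  simpa only [apply_indicatorSeq_diff_of_finite hψ _ hD] using
    sum_norm_apply_indicatorSeq_le ψ disjoint_diff

theorem countable_setOf_apply_indicatorSeq_ne_zero {ψ : StrongDual 𝕜 (EllInfty 𝕜)}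
    (hψ : ∀ n, ψ (indicatorSeq 𝕜 {n}) = 0) {ι : Type*} {B : ι → Set ℕ}
    (hB : Pairwise fun s t => (B s ∩ B t).Finite) :
    {t | ψ (indicatorSeq 𝕜 (B t)) ≠ 0}.Countable := by
  have hsum : Summable fun t => ‖ψ (indicatorSeq 𝕜 (B t))‖ :=
    summable_of_sum_le (fun t => norm_nonneg _)
      (sum_norm_apply_indicatorSeq_le_of_finite_inter hψ hB)
  simpa only [Function.support, norm_ne_zero_iff] using hsum.countable_support

theorem exists_infinite_forall_apply_indicatorSeq_eq_zero {ι : Type*} [Countable ι]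
    {ψ : ι → StrongDual 𝕜 (EllInfty 𝕜)} (hψ : ∀ i n, ψ i (indicatorSeq 𝕜 {n}) = 0) :
    ∃ M : Set ℕ, M.Infinite ∧ ∀ i, ψ i (indicatorSeq 𝕜 M) = 0 := by
  have hcount : (⋃ i, {t | ψ i (indicatorSeq 𝕜 (branch t)) ≠ 0}).Countable :=
    Set.countable_iUnion fun i =>
      countable_setOf_apply_indicatorSeq_ne_zero (hψ i) fun s t => finite_branch_inter
  have : Uncountable (ℕ → Bool) := Cardinal.aleph0_lt_mk_iff.1 (by
    simpa using Cardinal.cantor Cardinal.aleph0)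
  obtain ⟨t, -, ht⟩ := Set.not_subset.1 (mt hcount.mono Set.not_countable_univ)
  exact ⟨branch t, infinite_branch t, by simpa using ht⟩

end EllInfty

section Multiplier

variable {𝕜 : Type*} [RCLike 𝕜] {E : Type*} [NormedAddCommGroup E] [NormedSpace 𝕜 E]

/-- The operator `x ↦ (f n x)ₙ` into `ℓ^∞` given by a bounded sequence of functionals. -/
noncomputable def seqOp (f : ℕ → StrongDual 𝕜 E) (C : ℝ) (hf : ∀ n, ‖f n‖ ≤ C) :
    E →L[𝕜] EllInfty 𝕜 :=
  LinearMap.mkContinuous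
    { toFun := fun x => ⟨fun n => f n x, memℓp_infty ⟨C * ‖x‖, by
        rintro _ ⟨n, rfl⟩
        exact (f n).le_of_opNorm_le (hf n) x⟩⟩
      map_add' := fun x y => by ext n; exact map_add (f n) x y
      map_smul' := fun c x => by ext n; exact map_smul (f n) c x } C
    fun x => lp.norm_le_of_forall_le
      (mul_nonneg ((norm_nonneg _).trans (hf 0)) (norm_nonneg x))
      fun n => (f n).le_of_opNorm_le (hf n) x

theorem IsLDPSet.isDPcc_seqOp {A : Set (StrongDual 𝕜 E)} (hA : IsLDPSet 𝕜 A)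
    {f : ℕ → StrongDual 𝕜 E} (hfA : ∀ n, f n ∈ A) {C : ℝ} (hf : ∀ n, ‖f n‖ ≤ C) :
    IsDPcc (seqOp f C hf) := by
  intro x hx hDP
  refine tendsto_zero_iff_norm_tendsto_zero.2 (Metric.nhds_basis_closedBall.tendsto_right_iff.2 ?_)
  intro ε hε
  filter_upwards [SeminormedAddGroup.tendstoUniformlyOn_zero.1 (hA.2 x hx hDP) ε hε] with n hn
  simpa using lp.norm_le_of_forall_le hε.le fun k => (hn (f k) (hfA k)).le

section NormedAlgebra

variable {R : Type*} [NormedRing R] [NormedAlgebra 𝕜 R]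

/-- The operators `x ↦ b * T x`, depending linearly on the multiplier `b`. For `R = ℓ^∞` the
multiplication is coordinatewise, and finitely supported `b` give operators of finite rank. -/
noncomputable def multiplier (T : E →L[𝕜] R) : R →L[𝕜] E →L[𝕜] R :=
  ((ContinuousLinearMap.compL 𝕜 E R R).flip T).comp (ContinuousLinearMap.mul 𝕜 R)

theorem multiplier_apply (T : E →L[𝕜] R) (b : R) (x : E) : multiplier T b x = b * T x :=
  rfl

theorem IsDPcc.multiplier {T : E →L[𝕜] R} (hT : IsDPcc T) (b : R) :
    IsDPcc (multiplier T b) := fun x hx hDP => by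
  simpa only [multiplier_apply, mul_zero] using (hT x hx hDP).const_mul b

end NormedAlgebra

theorem multiplier_indicatorSeq_apply_of_mem (T : E →L[𝕜] EllInfty 𝕜) {M : Set ℕ} {n : ℕ}
    (hn : n ∈ M) (x : E) : multiplier T (indicatorSeq 𝕜 M) x n = T x n := by
  rw [multiplier_apply, lp.infty_coeFn_mul, Pi.mul_apply, indicatorSeq_apply,
    Set.indicator_of_mem hn, Pi.one_apply, one_mul]

theorem multiplier_indicatorSeq_singleton_apply (T : E →L[𝕜] EllInfty 𝕜) (n : ℕ) (x : E) :
    multiplier T (indicatorSeq 𝕜 {n}) x = T x n • indicatorSeq 𝕜 {n} := by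
  ext k
  rcases eq_or_ne k n with rfl | hk
  · simp [multiplier_apply, lp.infty_coeFn_mul, indicatorSeq_apply]
  · simp [multiplier_apply, lp.infty_coeFn_mul, indicatorSeq_apply, hk]

theorem isWeaklyCompactOp_multiplier_indicatorSeq_singleton (T : E →L[𝕜] EllInfty 𝕜) (n : ℕ) :
    IsWeaklyCompactOp (multiplier T (indicatorSeq 𝕜 {n})) := by
  have hline : Continuous fun c : 𝕜 => toWeakSpaceCLM 𝕜 (EllInfty 𝕜) (c • indicatorSeq 𝕜 {n}) :=
    (toWeakSpaceCLM 𝕜 (EllInfty 𝕜)).continuous.comp (continuous_id.smul continuous_const)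
  refine isWeaklyCompactOp_of_subset
    ((isCompact_closedBall (0 : 𝕜) ‖T‖).image hline) fun x hx => ⟨T x n, ?_, ?_⟩
  · exact mem_closedBall_zero_iff.2 ((lp.norm_apply_le_norm ENNReal.top_ne_zero _ n).trans
      (T.unit_le_opNorm x (mem_closedBall_zero_iff.1 hx)))
  · exact congrArg (toWeakSpace 𝕜 (EllInfty 𝕜)) (multiplier_indicatorSeq_singleton_apply T n x).symm

theorem ComplementedIn.exists_clm_eqOn_preimage {G : Type*} [NormedAddCommGroup G]
    [NormedSpace 𝕜 G] {p q : Submodule 𝕜 E} (h : ComplementedIn p q) {B : G →L[𝕜] E}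
    (hB : ∀ b, B b ∈ q) :
    ∃ B' : G →L[𝕜] E, (∀ b, B' b ∈ p) ∧ Set.EqOn B' B (B ⁻¹' p) := by
  obtain ⟨-, P, hP⟩ := h
  exact ⟨q.subtypeL.comp ((p.submoduleOf q).subtypeL.comp (P.comp (B.codRestrict q hB))),
    fun b => (P _).2,
    fun b hb => congrArg (fun z : p.submoduleOf q => ((z : q) : E)) (hP ⟨⟨B b, hB b⟩, hb⟩)⟩

/-- With `P` the projection, `b ↦ b T - P (b T)` vanishes at finitely supported `b`, hence, as far
as the countably many numbers in the conclusion can tell, at the indicator of an infinite `M`. -/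
theorem ComplementedIn.exists_mem_infinite_eqOn {p q : Submodule 𝕜 (E →L[𝕜] EllInfty 𝕜)}
    (h : ComplementedIn p q) {T : E →L[𝕜] EllInfty 𝕜} (hq : ∀ b, multiplier T b ∈ q)
    (hp : ∀ n, multiplier T (indicatorSeq 𝕜 {n}) ∈ p) (x : ℕ → E) :
    ∃ R ∈ p, ∃ M : Set ℕ, M.Infinite ∧ ∀ m, Set.EqOn (R (x m)) (T (x m)) M := by
  obtain ⟨B, hBp, hB⟩ := h.exists_clm_eqOn_preimage hq
  let ψ : ℕ × ℕ → StrongDual 𝕜 (EllInfty 𝕜) := fun i =>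
    (lp.evalCLM 𝕜 (fun _ : ℕ => 𝕜) ∞ i.2).comp ((multiplier T - B).flip (x i.1))
  have hψ (i : ℕ × ℕ) (b : EllInfty 𝕜) :
      ψ i b = multiplier T b (x i.1) i.2 - B b (x i.1) i.2 := rfl
  obtain ⟨M, hM, hψM⟩ := exists_infinite_forall_apply_indicatorSeq_eq_zero (ψ := ψ) fun i n => by
    rw [hψ, hB (hp n), sub_self]
  refine ⟨B (indicatorSeq 𝕜 M), hBp _, M, hM, fun m n hn => ?_⟩
  rw [← multiplier_indicatorSeq_apply_of_mem T hn]
  exact (sub_eq_zero.1 (hψM (m, n))).symm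

theorem norm_evalCLM_le (n : ℕ) : ‖lp.evalCLM 𝕜 (fun _ : ℕ => 𝕜) ∞ n‖ ≤ 1 :=
  LinearMap.mkContinuous_norm_le _ zero_le_one _

theorem IsWeaklyCompactOp.iteratedLimits_eq {T : E →L[𝕜] EllInfty 𝕜} (hT : IsWeaklyCompactOp T)
    {x : ℕ → E} (hx : ∀ m, x m ∈ Metric.closedBall (0 : E) 1) {w : ℕ → ℕ → 𝕜}
    {M : Set ℕ} (hM : M.Infinite) (hTw : ∀ m, Set.EqOn (T (x m)) (w m) M) {u v : ℕ → 𝕜} {r s : 𝕜}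
    (hu : ∀ n, Tendsto (fun m => w m n) atTop (𝓝 (u n))) (hr : Tendsto u atTop (𝓝 r))
    (hv : ∀ m, Tendsto (w m) atTop (𝓝 (v m))) (hs : Tendsto v atTop (𝓝 s)) : r = s := by
  have hσ : Tendsto (Nat.nth (· ∈ M)) atTop atTop := (Nat.nth_strictMono hM).tendsto_atTop
  have heval (m k : ℕ) : lp.evalCLM 𝕜 (fun _ : ℕ => 𝕜) ∞ (Nat.nth (· ∈ M) k) (T (x m)) =
      w m (Nat.nth (· ∈ M) k) := hTw m (Nat.nth_mem_of_infinite hM k)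
  refine (hT.iteratedLimitsAgree x (fun k => lp.evalCLM 𝕜 (fun _ : ℕ => 𝕜) ∞ (Nat.nth (· ∈ M) k))
    hx (fun k => mem_closedBall_zero_iff.2 (norm_evalCLM_le _)) v (u ∘ Nat.nth (· ∈ M)) s r
    ?_ hs ?_ (hr.comp hσ)).symm
  · simp only [heval]
    exact fun m => (hv m).comp hσ
  · simp only [heval]
    exact fun k => hu (Nat.nth (· ∈ M) k)

theorem HasLDPProperty.of_complementedIn
    (h : ComplementedIn (W 𝕜 E (EllInfty 𝕜)) (DPcc 𝕜 E (EllInfty 𝕜))) : HasLDPProperty 𝕜 E := by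
  refine fun A hA => IteratedLimitsAgree.relWeaklyCompact_dual ?_ hA.1
  intro f x hf hx u v r s hu hr hv hs
  obtain ⟨C, hC⟩ := isBounded_iff_forall_norm_le.1 hA.1
  have hT : IsDPcc (seqOp f C fun n => hC _ (hf n)) := hA.isDPcc_seqOp hf _
  obtain ⟨R, hR, M, hM, hRM⟩ := h.exists_mem_infinite_eqOn hT.multiplier
    (isWeaklyCompactOp_multiplier_indicatorSeq_singleton _) x
  exact IsWeaklyCompactOp.iteratedLimits_eq hR hx (w := fun m n => f n (x m)) hM hRM hu hr hv hs

end Multiplier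

end LDP

theorem mainTheorem3_general {𝕜 : Type*} [RCLike 𝕜]
    {X : Type*} [NormedAddCommGroup X] [NormedSpace 𝕜 X] :
    List.TFAE
      [LDP.HasLDPProperty 𝕜 X,
        LDP.W 𝕜 X (LDP.EllInfty 𝕜) = LDP.DPcc 𝕜 X (LDP.EllInfty 𝕜),
        LDP.ComplementedIn (LDP.W 𝕜 X (LDP.EllInfty 𝕜)) (LDP.DPcc 𝕜 X (LDP.EllInfty 𝕜))] := by
  tfae_have 1 → 2 := fun h => h.W_eq_DPcc
  tfae_have 2 → 3 := fun h => h ▸ LDP.complementedIn_refl _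
  tfae_have 3 → 1 := LDP.HasLDPProperty.of_complementedIn
  tfae_finish

theorem mainTheorem3 {𝕜 : Type*} [RCLike 𝕜]
    {X : Type*} [NormedAddCommGroup X] [NormedSpace 𝕜 X] [CompleteSpace X] :
    List.TFAE
      [LDP.HasLDPProperty 𝕜 X,
        LDP.W 𝕜 X (LDP.EllInfty 𝕜) = LDP.DPcc 𝕜 X (LDP.EllInfty 𝕜),
        LDP.ComplementedIn (LDP.W 𝕜 X (LDP.EllInfty 𝕜)) (LDP.DPcc 𝕜 X (LDP.EllInfty 𝕜))] :=
  mainTheorem3_general
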